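/- \textbf{The game.} Let $\Gamma$ be a connected simple graph, $v$ a vertex, and $n,\sigma,\psi,\rho,R\ge 1$ integers. First the cop player chooses starting vertices for $n$ cops, then the robber chooses a starting vertex. In each stage, first every cop moves along an edge path of length at most $\sigma$, and then the robber moves along an edge path of length at most $\psi$; both players have perfect information. The cop player wins if the robber is captured, i.e. if in some stage, after the cops have moved, the robber is at, or on their move passes through, a vertex at distance at most $\rho$ from the position of some cop, or if from some stage on the robber is never in the closed ball of radius $R$ around $v$. The \emph{strong cop number} of $\Gamma$ is $$\operatorname{sCop}(\Gamma)=\inf\left\{n\ge 1 : \begin{array}{l}\forall v\in\Gamma,\ \exists\sigma\ge 1,\ \forall\psi\ge 1,\ \exists\rho\ge 1,\ \forall R\ge 1:\\ \text{the cop player has a winning strategy with } n \text{ cops}\end{array}\right\}\in\{1,2,\dots\}\cup\{\infty\}.$$ The strong cop number $\operatorname{sCop}(G)$ of a finitely generated group $G$ is $\operatorname{sCop}(\operatorname{Cay}(G,S))$ for a finite generating set $S$. \textbf{Theorem.} Let $F$ be Thompson's group, i.e. the group, under composition, of orientation-preserving piecewise linear homeomorphisms of $[0,1]$ with finitely many breakpoints,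 all of them dyadic rationals, and with all slopes integer powers of $2$. Then $F$ is finitely generated and has infinite strong cop number: $\operatorname{sCop}(\operatorname{Cay}(F,S))=\infty$ for every finite generating set $S$ of $F$. -/

import Mathlib

/-! ### Thompson's group F -/

/-- A real number is a dyadic rational if it is of the form `m / 2 ^ n`. -/
def IsDyadic (x : ℝ) : Prop := ∃ (m : ℤ) (n : ℕ), x = m / 2 ^ n

/-- An increasing bijection `f` of `[0, 1]` (that is, an orientation preserving homeomorphism) is
dyadic piecewise linear if there is a finite set `D` of dyadic rationals in `[0, 1]` such that, on
every closed interval `[a, b]` whose interior contains no point of `D`, the map `f` is affine with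
slope an integer power of `2`. -/
def IsDyadicPL (f : unitInterval ≃o unitInterval) : Prop :=
  ∃ D : Finset unitInterval, (∀ d ∈ D, IsDyadic (d : ℝ)) ∧
    ∀ a b : unitInterval, a ≤ b → (∀ d ∈ D, d ∉ Set.Ioo a b) →
      ∃ k : ℤ, ∀ x ∈ Set.Icc a b, ((f x : ℝ) = f a + (2 : ℝ) ^ k * ((x : ℝ) - a))

theorem IsDyadic.add {x y : ℝ} (hx : IsDyadic x) (hy : IsDyadic y) : IsDyadic (x + y) := by
  obtain ⟨m, n, rfl⟩ := hx
  obtain ⟨m', n', rfl⟩ := hy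
  refine ⟨m * 2 ^ n' + m' * 2 ^ n, n + n', ?_⟩
  push_cast
  field_simp
  ring

theorem IsDyadic.neg {x : ℝ} (hx : IsDyadic x) : IsDyadic (-x) := by
  obtain ⟨m, n, rfl⟩ := hx
  refine ⟨-m, n, ?_⟩
  push_cast
  ring

theorem IsDyadic.zpow_mul {x : ℝ} (hx : IsDyadic x) (k : ℤ) : IsDyadic ((2 : ℝ) ^ k * x) := by
  obtain ⟨m, n, rfl⟩ := hx
  obtain ⟨j, rfl | rfl⟩ := k.eq_nat_or_neg
  · refine ⟨2 ^ j * m, n, ?_⟩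
    push_cast
    rw [zpow_natCast]
    ring
  · refine ⟨m, n + j, ?_⟩
    rw [zpow_neg, zpow_natCast]
    field_simp
    ring

theorem IsDyadicPL.map_dyadic {f : unitInterval ≃o unitInterval} (hf : IsDyadicPL f)
    (x : unitInterval) (hx : IsDyadic (x : ℝ)) : IsDyadic (f x : ℝ) := by
  obtain ⟨D, hD, h⟩ := hf
  induction hn : (D.filter (· < x)).card using Nat.strong_induction_on generalizing x with
  | _ n ih =>
    -- a dyadic starting point `a ≤ x` with dyadic image and no point of `D` between
    have key : ∃ a : unitInterval, a ≤ x ∧ IsDyadic (a : ℝ) ∧ IsDyadic (f a : ℝ) ∧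
        ∀ d ∈ D, d ∉ Set.Ioo a x := by
      by_cases hne : (D.filter (· < x)).Nonempty
      · have hm := Finset.max'_mem _ hne
        set d := (D.filter (· < x)).max' hne with hd
        rw [Finset.mem_filter] at hm
        refine ⟨d, hm.2.le, hD d hm.1, ?_, ?_⟩
        · refine ih _ ?_ d (hD d hm.1) rfl
          rw [← hn]
          apply Finset.card_lt_card
          refine Finset.ssubset_iff_subset_ne.2 ⟨?_, ?_⟩
          · intro e he
            rw [Finset.mem_filter] at he ⊢
            exact ⟨he.1, he.2.trans hm.2⟩
          · intro heq
            have : d ∈ D.filter (· < d) := by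
              rw [heq, Finset.mem_filter]
              exact hm
            exact lt_irrefl _ (Finset.mem_filter.1 this).2
        · intro e he hI
          exact absurd (Finset.le_max' _ e (Finset.mem_filter.2 ⟨he, hI.2⟩)) (not_le.2 hI.1)
      · refine ⟨⊥, bot_le, ⟨0, 0, ?_⟩, ⟨0, 0, ?_⟩, ?_⟩
        · simp
        · simp [map_bot]
        · intro e he hI
          exact hne ⟨e, Finset.mem_filter.2 ⟨he, hI.2⟩⟩
    obtain ⟨a, hax, ha, hfa, hI⟩ := key
    obtain ⟨k, hk⟩ := h a x hax hI
    rw [hk x ⟨hax, le_rfl⟩, sub_eq_add_neg]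
    exact hfa.add ((hx.add ha.neg).zpow_mul k)

theorem IsDyadicPL.one : IsDyadicPL 1 := by
  refine ⟨∅, by simp, fun a b _ _ => ⟨0, fun x _ => ?_⟩⟩
  simp

theorem IsDyadicPL.inv {f : unitInterval ≃o unitInterval} (hf : IsDyadicPL f) :
    IsDyadicPL f⁻¹ := by
  classical
  have hdy := hf.map_dyadic
  obtain ⟨D, hD, h⟩ := hf
  refine ⟨D.image f, ?_, ?_⟩
  · intro d hd
    obtain ⟨e, he, rfl⟩ := Finset.mem_image.1 hd
    exact hdy e (hD e he)
  · intro a b hab hI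
    obtain ⟨k, hk⟩ := h (f.symm a) (f.symm b) (f.symm.monotone hab) (by
      intro d hd hdI
      refine hI (f d) (Finset.mem_image_of_mem _ hd) ⟨?_, ?_⟩
      · exact f.symm_apply_lt.1 hdI.1
      · exact f.lt_symm_apply.1 hdI.2)
    refine ⟨-k, fun x hx => ?_⟩
    have := hk (f.symm x) ⟨f.symm.monotone hx.1, f.symm.monotone hx.2⟩
    rw [f.apply_symm_apply, f.apply_symm_apply] at this
    change ((f.symm x : unitInterval) : ℝ) = (f.symm a : unitInterval) + _
    rw [this, zpow_neg]
    field_simp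
    ring

theorem IsDyadicPL.mul {f g : unitInterval ≃o unitInterval} (hf : IsDyadicPL f)
    (hg : IsDyadicPL g) : IsDyadicPL (f * g) := by
  classical
  have hdy := hg.inv.map_dyadic
  obtain ⟨D, hD, h⟩ := hf
  obtain ⟨E, hE, h'⟩ := hg
  refine ⟨E ∪ D.image g.symm, ?_, ?_⟩
  · intro d hd
    rcases Finset.mem_union.1 hd with hd | hd
    · exact hE d hd
    · obtain ⟨e, he, rfl⟩ := Finset.mem_image.1 hd
      exact hdy e (hD e he)
  · intro a b hab hI
    obtain ⟨k, hk⟩ := h' a b hab fun d hd => hI d (Finset.mem_union_left _ hd)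
    obtain ⟨l, hl⟩ := h (g a) (g b) (g.monotone hab) (by
      intro d hd hdI
      refine hI (g.symm d) (Finset.mem_union_right _ (Finset.mem_image_of_mem _ hd)) ⟨?_, ?_⟩
      · exact g.lt_symm_apply.2 hdI.1
      · exact g.symm_apply_lt.2 hdI.2)
    refine ⟨l + k, fun x hx => ?_⟩
    have h1 := hl (g x) ⟨g.monotone hx.1, g.monotone hx.2⟩
    rw [hk x hx] at h1
    rw [RelIso.mul_apply, RelIso.mul_apply, h1, zpow_add₀ (by norm_num)]
    ring

/-- Thompson's group `F`: the orientation preserving piecewise linear homeomorphisms of `[0, 1]`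
with finitely many breakpoints, all of them dyadic rationals, and all slopes powers of `2`, under
composition. -/
def ThompsonF : Subgroup (unitInterval ≃o unitInterval) where
  carrier := {f | IsDyadicPL f}
  one_mem' := IsDyadicPL.one
  mul_mem' := IsDyadicPL.mul
  inv_mem' := IsDyadicPL.inv

/-! ### The cops and robber game and the strong cop number -/

namespace CopGame

variable {V : Type*}

/-- An infinite sequence of legal robber moves of speed `ψ`: `pos 0` is the starting vertex and,
in stage `i`, the robber moves along `walk i` (of length at most `ψ`) from `pos i` to
`pos (i + 1)`. -/
structure RobberPlay (Γ : SimpleGraph V) (ψ : ℕ) where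
  pos : ℕ → V
  walk : ∀ i, Γ.Walk (pos i) (pos (i + 1))
  length_le : ∀ i, (walk i).length ≤ ψ

/-- The routes (lists of visited vertices, in order) taken by the robber in stages `0, …, i - 1`. -/
def RobberPlay.history {Γ : SimpleGraph V} {ψ : ℕ} (p : RobberPlay Γ ψ) (i : ℕ) : List (List V) :=
  (List.range i).map fun j => (p.walk j).support

/-- A strategy for the player with `n` cops: the starting vertices of the cops, and the vertices
to which they move as a function of everything that the robber has done so far, namely
the starting vertex of the robber and the routes taken by the robber in the previous stages. -/
structure CopStrategy (V : Type*) (n : ℕ) where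
  start : Fin n → V
  next : V → List (List V) → Fin n → V

/-- Positions of the cops when they follow the strategy `S` against the robber play `p`:
`S.pos p 0` are the starting positions and `S.pos p (i + 1)` the positions after the cop move of
stage `i`, which precedes the robber move `p.walk i`. -/
def CopStrategy.pos {n : ℕ} (S : CopStrategy V n) {Γ : SimpleGraph V} {ψ : ℕ}
    (p : RobberPlay Γ ψ) : ℕ → Fin n → V
  | 0 => S.start
  | i + 1 => S.next (p.pos 0) (p.history i)

/-- The cops only make legal moves of speed `σ`. -/
def IsLegal (Γ : SimpleGraph V) {n : ℕ} (σ : ℕ) {ψ : ℕ} (S : CopStrategy V n)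
    (p : RobberPlay Γ ψ) : Prop :=
  ∀ i k, Γ.edist (S.pos p i k) (S.pos p (i + 1) k) ≤ σ

/-- The robber is captured: in some stage, after the cop move, the robber is at or passes through
a vertex at distance at most `ρ` from some cop (the route includes both of its endpoints). -/
def IsCaptured (Γ : SimpleGraph V) {n : ℕ} (ρ : ℕ) {ψ : ℕ} (S : CopStrategy V n)
    (p : RobberPlay Γ ψ) : Prop :=
  ∃ i k, ∃ x ∈ (p.walk i).support, Γ.edist (S.pos p (i + 1) k) x ≤ ρ

/-- From some stage on, the robber never is in the closed ball of radius `R` around `v`. -/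
def IsDefended (Γ : SimpleGraph V) (v : V) (R : ℕ) {ψ : ℕ} (p : RobberPlay Γ ψ) : Prop :=
  ∃ N : ℕ, ∀ i, N ≤ i → ∀ x ∈ (p.walk i).support, (R : ℕ∞) < Γ.edist v x

/-- The player with `n` cops has a winning strategy in the game on `Γ` with treasure `v`, cop speed
`σ`, robber speed `ψ`, cop reach `ρ` and robber radius `R`. -/
def HasWinningStrategy (Γ : SimpleGraph V) (n : ℕ) (v : V) (σ ψ ρ R : ℕ) : Prop :=
  ∃ S : CopStrategy V n, ∀ p : RobberPlay Γ ψ,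
    IsLegal Γ σ S p ∧ (IsCaptured Γ ρ S p ∨ IsDefended Γ v R p)

/-- `n` strong cops suffice on `Γ`: the parameters are chosen in the order `σ`, `ψ`, `ρ`, `R`. -/
def StrongCopsWin (Γ : SimpleGraph V) (n : ℕ) : Prop :=
  ∀ v : V, ∃ σ : ℕ, 1 ≤ σ ∧ ∀ ψ : ℕ, 1 ≤ ψ → ∃ ρ : ℕ, 1 ≤ ρ ∧ ∀ R : ℕ, 1 ≤ R →
    HasWinningStrategy Γ n v σ ψ ρ R

/-- The strong cop number of a graph, the infimum of the empty set being `⊤`. -/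
noncomputable def sCop (Γ : SimpleGraph V) : ℕ∞ :=
  ⨅ (n : ℕ) (_ : 1 ≤ n ∧ StrongCopsWin Γ n), (n : ℕ∞)

end CopGame

/-! The base-2 logarithms of the slopes at 0 and 1 give two homomorphisms `F → ℤ`. An element
supported near 0 and one that fixes a neighbourhood of 0 and has slope 2 at 1 commute, and they map
to the standard basis of `ℤ²`. So `F` retracts onto `ℤ²`, and `sCop_eq_top` applies.

The coordinates are Lipschitz on the whole Cayley graph, so every cop has a shadow in `ℤ²` of
bounded speed, and the robber can stay in the lattice (`not_strongCopsWin_of_retract`). There the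
robber runs along `n + 1` horizontal and `n + 1` vertical lines with spacing `D`. By pigeonhole some
line of each direction has no shadow within `D / 2` (`exists_clear`), and their crossing is the next
target. The robber's speed, fixed after `σ`, lets a clear line stay clear until the robber has left
it; `D`, fixed after `ρ`, absorbs the reach of the cops. The grid is bounded, and `R` is fixed last,
so the robber never leaves the ball.

For finite generation, consider maps sending every `[2⁻¹ ^ (m + 1), 2⁻¹ ^ m]` affinely onto a
standard dyadic interval, eventually one of the form `[1 / 2 ^ k, 2 / 2 ^ k]`. If such a map is not
the identity, two adjacent images are siblings (`exists_siblings`); composing with some `shrink m`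
merges them, and induction shows that the map is a product of generators (`mem_generated`). Any `f`
in `F` becomes such a map after composition with a sufficiently fine one (`eq_generated`). -/

namespace CopGame

/-! ### Robber strategies -/

/-- The sequence defined by a rule that computes each term from the earlier ones. -/
noncomputable def seqOf {α : Type*} [Inhabited α] (f : ℕ → (ℕ → α) → α) (k : ℕ) : α :=
  f k fun i => if _ : i < k then seqOf f i else default
termination_by k

/-- The condition on term `k` involves earlier terms only, so the default values that `seqOf` uses
for the later ones are harmless. -/
theorem exists_seq {α : Type*} [Inhabited α] (C : ℕ → (ℕ → α) → α → Prop)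
    (hC : ∀ k τ τ', (∀ i < k, τ i = τ' i) → ∀ x, C k τ x → C k τ' x)
    (h : ∀ k τ, ∃ x, C k τ x) : ∃ τ : ℕ → α, ∀ k, C k τ (τ k) := by
  choose f hf using h
  refine ⟨seqOf f, fun k => ?_⟩
  refine hC k (fun i => if _ : i < k then seqOf f i else default) _ ?_ _ ?_
  · intro i hi
    simp [hi]
  · rw [seqOf]
    exact hf _ _

variable {V : Type*} {Γ : SimpleGraph V} {ψ : ℕ}

theorem exists_walk_length_le {x y : V} (h : Γ.edist x y ≤ ψ) :
    ∃ w : Γ.Walk x y, w.length ≤ ψ := by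
  obtain ⟨w, hw⟩ := Γ.exists_walk_of_edist_ne_top
    (ne_top_of_le_ne_top (ENat.natCast_ne_top ψ) h)
  exact ⟨w, by rw [← hw] at h; exact_mod_cast h⟩

/-- The play of the robber through given positions along chosen shortest routes. -/
noncomputable def RobberPlay.ofPos (f : ℕ → V) (hf : ∀ i, Γ.edist (f i) (f (i + 1)) ≤ ψ) :
    RobberPlay Γ ψ where
  pos := f
  walk i := (exists_walk_length_le (hf i)).choose
  length_le i := (exists_walk_length_le (hf i)).choose_spec

theorem support_choose_congr {x y x' y' : V} (hx : x = x') (hy : y = y')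
    (h : Γ.edist x y ≤ ψ) (h' : Γ.edist x' y' ≤ ψ) :
    (exists_walk_length_le h).choose.support = (exists_walk_length_le h').choose.support := by
  subst hx hy
  rfl

/-- Causality: the cop move of a stage precedes the robber move. Equality of histories holds because
each chosen walk depends only on its endpoints, by proof irrelevance. -/
theorem pos_congr {n : ℕ} (S : CopStrategy V n) {f f' : ℕ → V}
    (hf : ∀ i, Γ.edist (f i) (f (i + 1)) ≤ ψ) (hf' : ∀ i, Γ.edist (f' i) (f' (i + 1)) ≤ ψ)
    {j : ℕ} (h : ∀ i < j, f i = f' i) :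
    S.pos (RobberPlay.ofPos f hf) j = S.pos (RobberPlay.ofPos f' hf') j := by
  cases j with
  | zero => rfl
  | succ i =>
    have hh : (RobberPlay.ofPos f hf).history i = (RobberPlay.ofPos f' hf').history i := by
      refine List.map_congr_left fun m hm => ?_
      have hm := List.mem_range.1 hm
      exact support_choose_congr (h m (by omega)) (h (m + 1) (by omega)) (hf m) (hf' m)
    change S.next (f 0) _ = S.next (f' 0) _
    rw [hh, h 0 (by omega)]

theorem edist_le_of_mem_support {x y z : V} (w : Γ.Walk x y) (hz : z ∈ w.support) :
    Γ.edist x z ≤ w.length := by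
  classical
  exact (SimpleGraph.edist_le (w.takeUntil z hz)).trans
    (by exact_mod_cast w.length_takeUntil_le_length hz)

/-- Interpolation between the two integers `H * x` and `H * y`, with `m` steps of `H` made. -/
theorem interp_mem {n H m : ℕ} (x y : Fin (n + 1)) (hm : m ≤ H) :
    0 ≤ (H : ℤ) * (x : ℕ) + ((y : ℕ) - (x : ℕ)) * (m : ℤ) ∧
      (H : ℤ) * (x : ℕ) + ((y : ℕ) - (x : ℕ)) * (m : ℤ) ≤ H * n := by
  have hx : ((x : ℕ) : ℤ) ≤ n := by have := x.is_le; omega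
  have hy : ((y : ℕ) : ℤ) ≤ n := by have := y.is_le; omega
  have hm' : (m : ℤ) ≤ H := by exact_mod_cast hm
  have e : (H : ℤ) * (x : ℕ) + ((y : ℕ) - (x : ℕ)) * (m : ℤ) = (H - m) * (x : ℕ) + m * (y : ℕ) := by
    ring
  rw [e]
  have h0 : (0 : ℤ) ≤ H - m := by omega
  constructor
  · positivity
  · calc (H - m : ℤ) * (x : ℕ) + m * (y : ℕ) ≤ (H - m) * n + m * n := by gcongr
      _ = H * n := by ring

/-- Some line of a family of `n + 1` equally spaced parallel lines is far from `n` points. -/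
theorem exists_clear {n : ℕ} (c : Fin n → ℤ) (D : ℤ) :
    ∃ x : Fin (n + 1), ∀ j, D ≤ 2 * |c j - D * (x : ℕ)| := by
  by_contra! h
  choose g hg using h
  -- Otherwise one of the `n` points is within `D / 2` of two different lines, which are at least
  -- `D` apart.
  obtain ⟨x, y, hxy, he⟩ := Fintype.exists_ne_map_eq_of_card_lt g (by simp)
  have hx := hg x
  have hy := hg y
  rw [he] at hx
  wlog hlt : x < y generalizing x y
  · exact this y x hxy.symm he.symm (by rw [he]; exact hy) (hg x) (by omega)
  have hD : 0 < D := by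
    have := abs_nonneg (c (g y) - D * (x : ℕ))
    linarith
  have h1 : ((x : ℕ) : ℤ) + 1 ≤ (y : ℕ) := by
    have : (x : ℕ) < y := hlt
    omega
  have h2 : D * ((x : ℕ) + 1) ≤ D * (y : ℕ) := by gcongr
  have h3 := abs_lt.1 (show |c (g y) - D * (x : ℕ)| < D - |c (g y) - D * (y : ℕ)| by linarith)
  have h4 := neg_abs_le (c (g y) - D * (y : ℕ))
  linarith [h3.1, h3.2]

/-! ### The robber's path along the grid -/

section Grid

variable {n : ℕ} (q H : ℕ) (τ : ℕ → Fin (n + 1) × Fin (n + 1))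

/-- Abscissa of the robber at stage `i` when it visits the crossings `τ 0, τ 1, …` of the grid
with spacing `q * H`, going from each crossing to the next one in `2 * H` stages, first
horizontally and then vertically. -/
def gridX (i : ℕ) : ℤ :=
  q * (H * ((τ (i / (2 * H))).1 : ℕ) +
    (((τ (i / (2 * H) + 1)).1 : ℕ) - ((τ (i / (2 * H))).1 : ℕ)) * ((min (i % (2 * H)) H : ℕ) : ℤ))

/-- The ordinate corresponding to `gridX`. -/
def gridY (i : ℕ) : ℤ :=
  q * (H * ((τ (i / (2 * H))).2 : ℕ) +
    (((τ (i / (2 * H) + 1)).2 : ℕ) - ((τ (i / (2 * H))).2 : ℕ)) * ((i % (2 * H) - H : ℕ) : ℤ))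

theorem gridX_congr {τ τ' : ℕ → Fin (n + 1) × Fin (n + 1)} {i : ℕ}
    (h : ∀ k ≤ i / (2 * H) + 1, τ k = τ' k) : gridX q H τ i = gridX q H τ' i := by
  rw [gridX, gridX, h _ le_rfl, h _ (Nat.le_succ _)]

theorem gridY_congr {τ τ' : ℕ → Fin (n + 1) × Fin (n + 1)} {i : ℕ}
    (h : ∀ k ≤ i / (2 * H) + 1, τ k = τ' k) : gridY q H τ i = gridY q H τ' i := by
  rw [gridY, gridY, h _ le_rfl, h _ (Nat.le_succ _)]

theorem abs_gridX_le (i : ℕ) : |0 - gridX q H τ i| ≤ ((n * q * H : ℕ) : ℤ) := by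
  obtain ⟨h1, h2⟩ := interp_mem (H := H) (τ (i / (2 * H))).1 (τ (i / (2 * H) + 1)).1
    (min_le_right (i % (2 * H)) H)
  rw [zero_sub, abs_neg, gridX, abs_of_nonneg (by positivity)]
  calc _ ≤ (q : ℤ) * (H * n) := by gcongr
    _ = _ := by push_cast; ring

theorem abs_gridY_le (hH : 0 < H) (i : ℕ) : |0 - gridY q H τ i| ≤ ((n * q * H : ℕ) : ℤ) := by
  have hm : i % (2 * H) - H ≤ H := by
    have := Nat.mod_lt i (show 0 < 2 * H by omega)
    omega
  obtain ⟨h1, h2⟩ := interp_mem (H := H) (τ (i / (2 * H))).2 (τ (i / (2 * H) + 1)).2 hm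
  rw [zero_sub, abs_neg, gridY, abs_of_nonneg (by positivity)]
  calc _ ≤ (q : ℤ) * (H * n) := by gcongr
    _ = _ := by push_cast; ring

theorem succ_div_mod {T : ℕ} (hT : 0 < T) (i : ℕ) :
    ((i + 1) / T = i / T ∧ (i + 1) % T = i % T + 1) ∨
      ((i + 1) / T = i / T + 1 ∧ (i + 1) % T = 0 ∧ i % T + 1 = T) := by
  have hlt := Nat.mod_lt i hT
  have e := Nat.div_add_mod i T
  rcases (show i % T + 1 < T ∨ i % T + 1 = T by omega) with h | h
  · left
    have e' : i + 1 = (i % T + 1) + T * (i / T) := by omega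
    rw [e', Nat.add_mul_div_left _ _ hT, Nat.add_mul_mod_self_left]
    simp [Nat.div_eq_of_lt h, Nat.mod_eq_of_lt h]
  · right
    have e' : i + 1 = T * (i / T + 1) := by rw [mul_add]; omega
    rw [e', Nat.mul_div_cancel_left _ hT, Nat.mul_mod_right]
    exact ⟨rfl, rfl, h⟩

theorem abs_fin_sub_le (x y : Fin (n + 1)) : |(((y : ℕ) : ℤ) - ((x : ℕ) : ℤ))| ≤ n := by
  have := x.is_le
  have := y.is_le
  rw [abs_le]
  omega

theorem abs_mul_step_le (x y : Fin (n + 1)) {m m' : ℕ} (hm : |(m : ℤ) - m'| ≤ 1) :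
    |(q : ℤ) * (H * (x : ℕ) + ((y : ℕ) - (x : ℕ)) * (m : ℤ)) -
      q * (H * (x : ℕ) + ((y : ℕ) - (x : ℕ)) * (m' : ℤ))| ≤ ((n * q : ℕ) : ℤ) := by
  have e : (q : ℤ) * (H * (x : ℕ) + ((y : ℕ) - (x : ℕ)) * (m : ℤ)) -
      q * (H * (x : ℕ) + ((y : ℕ) - (x : ℕ)) * (m' : ℤ)) =
        q * (((y : ℕ) - (x : ℕ)) * ((m : ℤ) - m')) := by ring
  rw [e, abs_mul, abs_mul, Nat.abs_cast]
  calc (q : ℤ) * (|((y : ℕ) : ℤ) - (x : ℕ)| * |(m : ℤ) - m'|) ≤ q * (n * 1) := by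
        gcongr
        exact abs_fin_sub_le x y
    _ = _ := by push_cast; ring

theorem abs_gridX_sub_le (hH : 0 < H) (i : ℕ) :
    |gridX q H τ i - gridX q H τ (i + 1)| ≤ ((n * q : ℕ) : ℤ) := by
  rcases succ_div_mod (show 0 < 2 * H by omega) i with ⟨h1, h2⟩ | ⟨h1, h2, h3⟩
  · rw [gridX, gridX, h1, h2]
    apply abs_mul_step_le
    rw [abs_le]
    omega
  · have hm : min (i % (2 * H)) H = H := by omega
    rw [gridX, gridX, h1, h2, hm]
    have : (q : ℤ) * (H * ((τ (i / (2 * H))).1 : ℕ) +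
      (((τ (i / (2 * H) + 1)).1 : ℕ) - ((τ (i / (2 * H))).1 : ℕ)) * (H : ℤ)) =
        q * (H * ((τ (i / (2 * H) + 1)).1 : ℕ)) := by ring
    rw [this]
    simp
    positivity

theorem abs_gridY_sub_le (hH : 0 < H) (i : ℕ) :
    |gridY q H τ i - gridY q H τ (i + 1)| ≤ ((n * q : ℕ) : ℤ) := by
  rcases succ_div_mod (show 0 < 2 * H by omega) i with ⟨h1, h2⟩ | ⟨h1, h2, h3⟩
  · rw [gridY, gridY, h1, h2]
    apply abs_mul_step_le
    rw [abs_le]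
    omega
  -- The first point of the new leg is the old leg's formula after `H` vertical steps.
  · have e : gridY q H τ (i + 1) = q * (H * ((τ (i / (2 * H))).2 : ℕ) +
      (((τ (i / (2 * H) + 1)).2 : ℕ) - ((τ (i / (2 * H))).2 : ℕ)) * ((H : ℕ) : ℤ)) := by
      rw [gridY, h1, h2]
      simp
      ring_nf
      simp
    rw [e, gridY]
    apply abs_mul_step_le
    rw [abs_le]
    omega

theorem gridY_of_mod_le {i : ℕ} (h : i % (2 * H) ≤ H) :
    gridY q H τ i = ((q * H : ℕ) : ℤ) * ((τ (i / (2 * H))).2 : ℕ) := by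
  rw [gridY, Nat.sub_eq_zero_of_le h]
  push_cast
  ring

theorem gridX_of_le_mod {i : ℕ} (h : H ≤ i % (2 * H)) :
    gridX q H τ i = ((q * H : ℕ) : ℤ) * ((τ (i / (2 * H) + 1)).1 : ℕ) := by
  rw [gridX, min_eq_right h]
  push_cast
  ring

end Grid

/-! ### The robber's win on a graph with a lattice retract -/

theorem abs_sub_le_of_forall {n : ℕ} {c : ℕ → Fin n → ℤ} {s : ℕ}
    (h : ∀ i k, |c i k - c (i + 1) k| ≤ (s : ℤ)) (k : Fin n) {i j : ℕ} (hij : i ≤ j) :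
    |c i k - c j k| ≤ ((s * (j - i) : ℕ) : ℤ) := by
  induction j, hij using Nat.le_induction with
  | base => simp
  | succ j hij ih =>
    have h1 := abs_sub_le (c i k) (c j k) (c (j + 1) k)
    have h2 := h j k
    have e : s * (j + 1 - i) = s * (j - i) + s := by
      rw [Nat.succ_sub hij, Nat.mul_succ]
    rw [e]
    push_cast at *
    linarith

/-- The cops cannot win on a graph that retracts coarsely onto the Euclidean lattice `ℤ × ℤ`. -/
theorem not_strongCopsWin_of_retract {V : Type*} {Γ : SimpleGraph V} (a b : V → ℤ) (L : ℕ)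
    (ha : ∀ (d : ℕ) x y, Γ.edist x y ≤ d → |a x - a y| ≤ ((L * d : ℕ) : ℤ))
    (hb : ∀ (d : ℕ) x y, Γ.edist x y ≤ d → |b x - b y| ≤ ((L * d : ℕ) : ℤ))
    (r : ℤ → ℤ → V) (har : ∀ x y, a (r x y) = x) (hbr : ∀ x y, b (r x y) = y)
    (hr : ∀ m : ℕ, ∃ M : ℕ, ∀ x y x' y', |x - x'| ≤ (m : ℤ) → |y - y'| ≤ (m : ℤ) →
      Γ.edist (r x y) (r x' y') ≤ M) (n : ℕ) : ¬ StrongCopsWin Γ n := by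
  intro hwin
  obtain ⟨σ, -, hσ⟩ := hwin (r 0 0)
  set s := L * σ with hs
  -- A cop's shadow moves at most `s` per stage, and a line must stay clear for at most `4 * H`
  -- stages. A margin of `q * H / 2` thus leaves `H / 2` after the cops' motion, and `H = 2 * K + 1`
  -- makes this exceed the reach `K`. Since `q` depends on `σ` only, the robber speed can be fixed
  -- before `ρ`.
  set q := 8 * s + 1 with hq
  obtain ⟨ψ, hψ⟩ := hr (n * q)
  obtain ⟨ρ, -, hρ⟩ := hσ (ψ + 1) (by omega)
  set K := L * ρ + L * (ψ + 1) with hK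
  set H := 2 * K + 1 with hH
  have hH0 : 0 < H := by omega
  obtain ⟨R, hR⟩ := hr (n * q * H)
  obtain ⟨S, hS⟩ := hρ (R + 1) (by omega)
  let f : (ℕ → Fin (n + 1) × Fin (n + 1)) → ℕ → V := fun τ i => r (gridX q H τ i) (gridY q H τ i)
  have hf : ∀ τ i, Γ.edist (f τ i) (f τ (i + 1)) ≤ (ψ + 1 : ℕ) := fun τ i =>
    (hψ _ _ _ _ (abs_gridX_sub_le q H τ hH0 i) (abs_gridY_sub_le q H τ hH0 i)).trans
      (by exact_mod_cast Nat.le_succ ψ)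
  let p := fun τ => RobberPlay.ofPos (f τ) (hf τ)
  -- Crossing `k` is selected from the cop positions at the start of the leg towards it. With
  -- truncated subtraction, crossings 0 and 1 both use the initial positions.
  let C : ℕ → (ℕ → Fin (n + 1) × Fin (n + 1)) → Fin (n + 1) × Fin (n + 1) → Prop := fun k τ x =>
    (∀ j, ((q * H : ℕ) : ℤ) ≤
      2 * |a (S.pos (p τ) ((k - 1) * (2 * H)) j) - ((q * H : ℕ) : ℤ) * (x.1 : ℕ)|) ∧
    ∀ j, ((q * H : ℕ) : ℤ) ≤
      2 * |b (S.pos (p τ) ((k - 1) * (2 * H)) j) - ((q * H : ℕ) : ℤ) * (x.2 : ℕ)|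
  obtain ⟨τ, hτ⟩ : ∃ τ, ∀ k, C k τ (τ k) := by
    refine exists_seq C ?_ ?_
    · intro k τ τ' h x hx
      have e : S.pos (p τ) ((k - 1) * (2 * H)) = S.pos (p τ') ((k - 1) * (2 * H)) := by
        refine pos_congr S (hf τ) (hf τ') fun i hi => ?_
        have hi' : i / (2 * H) < k - 1 := by
          rw [Nat.div_lt_iff_lt_mul (by omega)]
          exact hi
        have hi'' : ∀ l ≤ i / (2 * H) + 1, l < k := by
          generalize i / (2 * H) = z at hi' ⊢
          omega
        change r _ _ = r _ _
        rw [gridX_congr q H fun l hl => h l (hi'' l hl), gridY_congr q H fun l hl => h l (hi'' l hl)]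
      change (_ ∧ _) at hx
      change (_ ∧ _)
      rwa [e] at hx
    · intro k τ
      obtain ⟨x, hx⟩ := exists_clear
        (fun j => a (S.pos (p τ) ((k - 1) * (2 * H)) j)) ((q * H : ℕ) : ℤ)
      obtain ⟨y, hy⟩ := exists_clear
        (fun j => b (S.pos (p τ) ((k - 1) * (2 * H)) j)) ((q * H : ℕ) : ℤ)
      exact ⟨(x, y), hx, hy⟩
  obtain ⟨hleg, hcap | ⟨N, hN⟩⟩ := hS (p τ)
  · obtain ⟨i, k, x, hx, hd⟩ := hcap
    have hi := Nat.mod_lt i (show 0 < 2 * H by omega)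
    have hdm := Nat.div_add_mod i (2 * H)
    have hdist : Γ.edist (r (gridX q H τ i) (gridY q H τ i)) x ≤ (ψ + 1 : ℕ) :=
      (edist_le_of_mem_support _ hx).trans (by exact_mod_cast (p τ).length_le i)
    -- Both crossings of the current leg were selected at most `4 * H` stages before the cop
    -- position of stage `i`.
    have ref : ∀ m, (m = i / (2 * H) ∨ m = i / (2 * H) + 1) →
        (m - 1) * (2 * H) ≤ i + 1 ∧ i + 1 - (m - 1) * (2 * H) ≤ 4 * H := by
      rintro m (rfl | rfl)
      · rcases Nat.eq_zero_or_pos (i / (2 * H)) with h0 | h0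
        · rw [h0] at hdm ⊢
          omega
        · have : 2 * H * (i / (2 * H)) = (i / (2 * H) - 1) * (2 * H) + 2 * H := by
            rw [mul_comm, Nat.sub_mul, one_mul, Nat.sub_add_cancel]
            exact Nat.le_mul_of_pos_left _ h0
          omega
      · have : (i / (2 * H) + 1 - 1) * (2 * H) = 2 * H * (i / (2 * H)) := by
          rw [Nat.add_sub_cancel, mul_comm]
        omega
    -- One coordinate suffices: a capture puts the cop's shadow within `K` of the line being
    -- followed, too far from where it was when that line was selected.
    have contra : ∀ (g : V → ℤ) (m : ℕ) (z : ℤ),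
        (∀ (d : ℕ) x y, Γ.edist x y ≤ d → |g x - g y| ≤ ((L * d : ℕ) : ℤ)) →
        (m = i / (2 * H) ∨ m = i / (2 * H) + 1) →
        g (r (gridX q H τ i) (gridY q H τ i)) = z →
        ((q * H : ℕ) : ℤ) ≤ 2 * |g (S.pos (p τ) ((m - 1) * (2 * H)) k) - z| → False := by
      intro g m z hg hm hz hfar
      obtain ⟨h1, h2⟩ := ref m hm
      have h3 := abs_sub_le_of_forall (c := fun i k => g (S.pos (p τ) i k)) (s := s)
        (fun i k => hg σ _ _ (hleg i k)) k h1
      have h4 := hg _ _ _ hdist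
      have h5 := hg _ _ _ hd
      rw [hz] at h4
      have h6 : ((s * (i + 1 - (m - 1) * (2 * H)) : ℕ) : ℤ) ≤ ((s * (4 * H) : ℕ) : ℤ) := by
        exact_mod_cast Nat.mul_le_mul_left s h2
      have h7 : |g (S.pos (p τ) ((m - 1) * (2 * H)) k) - z| ≤ ((s * (4 * H) + K : ℕ) : ℤ) := by
        have t1 := abs_sub_le (g (S.pos (p τ) ((m - 1) * (2 * H)) k))
          (g (S.pos (p τ) (i + 1) k)) z
        have t2 := abs_sub_le (g (S.pos (p τ) (i + 1) k)) (g x) z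
        rw [abs_sub_comm z] at h4
        rw [hK]
        push_cast at *
        linarith
      have h8 : q * H ≤ 2 * (s * (4 * H) + K) := by
        zify
        push_cast at *
        linarith
      have h9 : q * H = 2 * (s * (4 * H)) + H := by rw [hq]; ring
      omega
    -- The first half of a leg follows the horizontal line of the old crossing, the second half the
    -- vertical line of the new one.
    rcases le_total (i % (2 * H)) H with h | h
    · refine contra b (i / (2 * H)) _ hb (Or.inl rfl) ?_ ((hτ _).2 k)
      rw [hbr, gridY_of_mod_le q H τ h]
    · refine contra a (i / (2 * H) + 1) _ ha (Or.inr rfl) ?_ ((hτ _).1 k)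
      rw [har, gridX_of_le_mod q H τ h]
  · have h := hN N le_rfl _ ((p τ).walk N).start_mem_support
    have h' := hR 0 0 _ _ (abs_gridX_le q H τ N) (abs_gridY_le q H τ hH0 N)
    exact absurd (h.trans_le h') (by push_cast; exact not_lt.2 le_self_add)

/-! ### Cayley graphs -/

section Cayley

variable {G : Type*} [Group G] {S : Set G}

theorem edist_mul_left_le (g x y : G) :
    (SimpleGraph.mulCayley S).edist (g * x) (g * y) ≤ (SimpleGraph.mulCayley S).edist x y := by
  by_cases h : (SimpleGraph.mulCayley S).edist x y = ⊤
  · rw [h]; exact le_top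
  · obtain ⟨w, hw⟩ := SimpleGraph.exists_walk_of_edist_ne_top h
    rw [← hw]
    let φ : SimpleGraph.mulCayley S →g SimpleGraph.mulCayley S :=
      ⟨fun z => g * z, fun h => (SimpleGraph.mulCayley_adj_mul_iff_right).2 h⟩
    exact (SimpleGraph.edist_le (w.map φ)).trans (by simp)

theorem reachable_mulCayley (hS : Subgroup.closure S = ⊤) (x y : G) :
    (SimpleGraph.mulCayley S).Reachable x y := by
  have key : ∀ g ∈ Subgroup.closure S, ∀ x, (SimpleGraph.mulCayley S).Reachable x (x * g) := by
    intro g hg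
    induction hg using Subgroup.closure_induction with
    | mem g hg =>
      intro x
      by_cases h : x = x * g
      · rw [← h]
      · refine SimpleGraph.Adj.reachable ?_
        rw [SimpleGraph.mulCayley_adj]
        exact ⟨h, Or.inl (by simpa using hg)⟩
    | one => intro x; simp
    | mul g h _ _ ihg ihh =>
      intro x
      rw [← mul_assoc]
      exact (ihg x).trans (ihh _)
    | inv g _ ih =>
      intro x
      have := (ih (x * g⁻¹)).symm
      simpa using this
  have := key (x⁻¹ * y) (by rw [hS]; trivial) x
  simpa using this

/-- A homomorphism changes along an edge by its value on a generator, up to sign, and there are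
finitely many generators. -/
theorem exists_lipschitz (hS : S.Finite) (a : G → ℤ) (ha : ∀ x y, a (x * y) = a x + a y) :
    ∃ L : ℕ, ∀ (d : ℕ) x y, (SimpleGraph.mulCayley S).edist x y ≤ d →
      |a x - a y| ≤ ((L * d : ℕ) : ℤ) := by
  obtain ⟨L, hL⟩ : ∃ L : ℕ, ∀ g ∈ S, |a g| ≤ (L : ℤ) := by
    obtain ⟨L, hL⟩ := (hS.image fun g => (a g).natAbs).bddAbove
    refine ⟨L, fun g hg => ?_⟩
    have : (a g).natAbs ≤ L := hL (Set.mem_image_of_mem _ hg)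
    rw [Int.abs_eq_natAbs]
    exact_mod_cast this
  have hw : ∀ x y (w : (SimpleGraph.mulCayley S).Walk x y),
      |a x - a y| ≤ ((L * w.length : ℕ) : ℤ) := by
    intro x y w
    induction w with
    | nil => simp
    | @cons x y z h w ih =>
      have h1 : |a x - a y| ≤ (L : ℤ) := by
        rw [SimpleGraph.mulCayley_adj'] at h
        obtain ⟨-, g, hg, rfl | rfl⟩ := h
        · rw [ha, abs_sub_comm, add_sub_cancel_left]
          exact hL g hg
        · rw [ha, add_sub_cancel_left]
          exact hL g hg
      have h2 := abs_sub_le (a x) (a y) (a z)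
      rw [SimpleGraph.Walk.length_cons]
      push_cast at *
      linarith
  refine ⟨L, fun d x y h => ?_⟩
  obtain ⟨w, hw'⟩ := exists_walk_length_le h
  exact (hw x y w).trans (by exact_mod_cast Nat.mul_le_mul_left L hw')

/-- A finitely generated group that retracts onto `ℤ × ℤ` has infinite strong cop number. -/
theorem sCop_eq_top (hS : S.Finite) (hS' : Subgroup.closure S = ⊤) (a b : G → ℤ)
    (ha : ∀ x y, a (x * y) = a x + a y) (hb : ∀ x y, b (x * y) = b x + b y) (u v : G)
    (huv : Commute u v) (hau : a u = 1) (hbu : b u = 0) (hav : a v = 0) (hbv : b v = 1) :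
    sCop (SimpleGraph.mulCayley S) = ⊤ := by
  have hzpow : ∀ (c : G → ℤ), (∀ x y, c (x * y) = c x + c y) → ∀ g (k : ℤ), c (g ^ k) = k * c g := by
    intro c hc g k
    let φ : G →* Multiplicative ℤ := MonoidHom.mk' (fun x => Multiplicative.ofAdd (c x))
      fun x y => by rw [hc, ofAdd_add]
    have : φ (g ^ k) = φ g ^ k := map_zpow φ g k
    have := congrArg Multiplicative.toAdd this
    simpa [φ] using this
  obtain ⟨L, hL⟩ := exists_lipschitz hS a ha
  obtain ⟨L', hL'⟩ := exists_lipschitz hS b hb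
  have key := not_strongCopsWin_of_retract (Γ := SimpleGraph.mulCayley S) a b (max L L')
    (fun d x y h => (hL d x y h).trans
      (by exact_mod_cast Nat.mul_le_mul_right d (le_max_left L L')))
    (fun d x y h => (hL' d x y h).trans
      (by exact_mod_cast Nat.mul_le_mul_right d (le_max_right L L')))
    (fun x y => u ^ x * v ^ y)
    (fun x y => by simp [ha, hzpow a ha, hau, hav])
    (fun x y => by simp [hb, hzpow b hb, hbu, hbv]) ?_
  · rw [sCop]
    simp only [iInf_eq_top]
    exact fun n hn => absurd hn.2 (key n)
  · intro m
    have hdist : ∀ x y : G, ∃ M : ℕ, (SimpleGraph.mulCayley S).edist x y ≤ M := fun x y =>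
      ⟨_, ((reachable_mulCayley hS' x y).coe_dist_eq_edist).ge⟩
    choose M hM using hdist
    let I := Finset.Icc (-(m : ℤ)) m ×ˢ Finset.Icc (-(m : ℤ)) m
    -- By left invariance only the distances from 1 to the finitely many `u ^ i * v ^ j` with `|i|,
    -- |j| ≤ m` matter.
    refine ⟨I.sup fun z => M 1 (u ^ z.1 * v ^ z.2), fun x y x' y' hx hy => ?_⟩
    have e : u ^ x' * v ^ y' = (u ^ x * v ^ y) * (u ^ (x' - x) * v ^ (y' - y)) := by
      rw [mul_assoc, ← mul_assoc (v ^ y), ((huv.zpow_zpow (x' - x) y).eq).symm, mul_assoc,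
        ← mul_assoc, ← zpow_add, ← zpow_add]
      simp
    have h1 := edist_mul_left_le (S := S) (u ^ x * v ^ y) 1 (u ^ (x' - x) * v ^ (y' - y))
    rw [mul_one, ← e] at h1
    refine h1.trans ((hM _ _).trans ?_)
    have hmem : (x' - x, y' - y) ∈ I := by
      rw [abs_le] at hx hy
      simp only [I, Finset.mem_product, Finset.mem_Icc]
      omega
    exact_mod_cast Finset.le_sup (f := fun z : ℤ × ℤ => M 1 (u ^ z.1 * v ^ z.2)) hmem

end Cayley
end CopGame
/-! ### Generators of Thompson's group -/

namespace ThompsonF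

/-- The piecewise linear map with slopes `1 / 2`, `1`, `2`, `1` and breakpoints
`c / 2`, `3 * c / 4`, `c`. -/
noncomputable def shrinkFun (c s : ℝ) : ℝ := min s (max (max (2 * s - c) (s - c / 4)) (s / 2))

/-- The inverse of `shrinkFun`. -/
noncomputable def stretchFun (c s : ℝ) : ℝ := max s (min (min ((s + c) / 2) (s + c / 4)) (2 * s))

section
variable {c s : ℝ}

theorem shrinkFun_of_le_half (h0 : 0 ≤ s) (h : s ≤ c / 2) : shrinkFun c s = s / 2 := by
  rw [shrinkFun, max_eq_right (a := max _ _) (max_le (by linarith) (by linarith)),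
    min_eq_right (by linarith)]

theorem shrinkFun_of_mid (h : c / 2 ≤ s) (h' : s ≤ 3 * c / 4) : shrinkFun c s = s - c / 4 := by
  rw [shrinkFun, max_eq_right (a := 2 * s - c) (by linarith), max_eq_left (by linarith),
    min_eq_right (by linarith)]

theorem shrinkFun_of_upper (h0 : 0 ≤ c) (h : 3 * c / 4 ≤ s) (h' : s ≤ c) :
    shrinkFun c s = 2 * s - c := by
  rw [shrinkFun, max_eq_left (b := s - c / 4) (by linarith), max_eq_left (by linarith),
    min_eq_right (by linarith)]

theorem shrinkFun_of_ge (h : c ≤ s) : shrinkFun c s = s :=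
  min_eq_left (le_max_of_le_left (le_max_of_le_left (by linarith)))

theorem stretchFun_of_le_quarter (h0 : 0 ≤ s) (h : s ≤ c / 4) : stretchFun c s = 2 * s := by
  rw [stretchFun, min_eq_right (a := min _ _) (le_min (by linarith) (by linarith)),
    max_eq_right (by linarith)]

theorem stretchFun_of_mid (h : c / 4 ≤ s) (h' : s ≤ c / 2) : stretchFun c s = s + c / 4 := by
  rw [stretchFun, min_eq_right (a := (s + c) / 2) (by linarith), min_eq_left (by linarith),
    max_eq_right (by linarith)]

theorem stretchFun_of_upper (h0 : 0 ≤ c) (h : c / 2 ≤ s) (h' : s ≤ c) :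
    stretchFun c s = (s + c) / 2 := by
  rw [stretchFun, min_eq_left (b := s + c / 4) (by linarith), min_eq_left (by linarith),
    max_eq_right (by linarith)]

theorem stretchFun_of_ge (h : c ≤ s) : stretchFun c s = s :=
  max_eq_left (min_le_of_left_le (min_le_of_left_le (by linarith)))

theorem stretchFun_shrinkFun (h0 : 0 ≤ c) (hs : 0 ≤ s) : stretchFun c (shrinkFun c s) = s := by
  rcases le_total s (c / 2) with h | h
  · rw [shrinkFun_of_le_half hs h, stretchFun_of_le_quarter (by linarith) (by linarith)]
    ring
  rcases le_total s (3 * c / 4) with h' | h'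
  · rw [shrinkFun_of_mid h h', stretchFun_of_mid (by linarith) (by linarith)]
    ring
  rcases le_total s c with h'' | h''
  · rw [shrinkFun_of_upper h0 h' h'', stretchFun_of_upper h0 (by linarith) (by linarith)]
    ring
  · rw [shrinkFun_of_ge h'', stretchFun_of_ge h'']

theorem shrinkFun_stretchFun (h0 : 0 ≤ c) (hs : 0 ≤ s) : shrinkFun c (stretchFun c s) = s := by
  rcases le_total s (c / 4) with h | h
  · rw [stretchFun_of_le_quarter hs h, shrinkFun_of_le_half (by linarith) (by linarith)]
    ring
  rcases le_total s (c / 2) with h' | h'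
  · rw [stretchFun_of_mid h h', shrinkFun_of_mid (by linarith) (by linarith)]
    ring
  rcases le_total s c with h'' | h''
  · rw [stretchFun_of_upper h0 h' h'', shrinkFun_of_upper h0 (by linarith) (by linarith)]
    ring
  · rw [stretchFun_of_ge h'', shrinkFun_of_ge h'']

/-- The map is a min and max of increasing affine functions. -/
theorem shrinkFun_mono (c : ℝ) : Monotone (shrinkFun c) := fun s t h => by
  unfold shrinkFun
  gcongr

theorem stretchFun_mono (c : ℝ) : Monotone (stretchFun c) := fun s t h => by
  unfold stretchFun
  gcongr


end

theorem pow_inv_pos (m : ℕ) : (0 : ℝ) < 2⁻¹ ^ m := by positivity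

theorem pow_inv_le_one (m : ℕ) : (2⁻¹ : ℝ) ^ m ≤ 1 := pow_le_one₀ (by norm_num) (by norm_num)

/-- The element of Thompson's group that shrinks `[0, 2⁻¹ ^ m]` towards `0`. -/
noncomputable def shrink (m : ℕ) : unitInterval ≃o unitInterval :=
  Equiv.toOrderIso
    { toFun := fun s => ⟨shrinkFun (2⁻¹ ^ m) s, by
        have h := shrinkFun_mono (2⁻¹ ^ m) s.2.1
        rwa [shrinkFun_of_le_half le_rfl (half_pos (pow_inv_pos m)).le, zero_div] at h,
        (min_le_left _ _).trans s.2.2⟩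
      invFun := fun s => ⟨stretchFun (2⁻¹ ^ m) s, s.2.1.trans (le_max_left _ _), by
        have h := stretchFun_mono (2⁻¹ ^ m) s.2.2
        rwa [stretchFun_of_ge (pow_inv_le_one m)] at h⟩
      left_inv := fun s => Subtype.ext (stretchFun_shrinkFun (pow_inv_pos m).le s.2.1)
      right_inv := fun s => Subtype.ext (shrinkFun_stretchFun (pow_inv_pos m).le s.2.1) }
    (fun _ _ h => shrinkFun_mono _ h) (fun _ _ h => stretchFun_mono _ h)

theorem coe_shrink (m : ℕ) (s : unitInterval) : (shrink m s : ℝ) = shrinkFun (2⁻¹ ^ m) s := rfl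

theorem coe_shrink_inv (m : ℕ) (s : unitInterval) :
    ((shrink m)⁻¹ s : ℝ) = stretchFun (2⁻¹ ^ m) s := rfl

theorem isDyadic_pow_inv_mul (i m : ℕ) : IsDyadic (i * 2⁻¹ ^ m) :=
  ⟨i, m, by rw [inv_pow]; push_cast; rfl⟩

theorem isDyadicPL_shrink (m : ℕ) : IsDyadicPL (shrink m) := by
  classical
  have hc := pow_inv_pos m
  have hc1 := pow_inv_le_one m
  set c : ℝ := 2⁻¹ ^ m with hcdef
  refine ⟨{⟨c / 2, by constructor <;> linarith⟩, ⟨3 * c / 4, by constructor <;> linarith⟩,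
    ⟨c, by constructor <;> linarith⟩}, ?_, ?_⟩
  · intro d hd
    simp only [Finset.mem_insert, Finset.mem_singleton] at hd
    rcases hd with rfl | rfl | rfl
    · convert isDyadic_pow_inv_mul 1 (m + 1) using 1
      rw [pow_succ, ← hcdef]; push_cast; ring
    · convert isDyadic_pow_inv_mul 3 (m + 2) using 1
      rw [pow_add, ← hcdef]; push_cast; ring
    · convert isDyadic_pow_inv_mul 1 m using 1
      simp [hcdef]
  · intro a b hab hD
    simp only [Finset.mem_insert, Finset.mem_singleton, forall_eq_or_imp, forall_eq, Set.mem_Ioo,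
      ← Subtype.coe_lt_coe, not_and, not_lt] at hD
    obtain ⟨h1, h2, h3⟩ := hD
    have ha := a.2.1
    have hab' : (a : ℝ) ≤ b := hab
    have cases3 : ∀ x ∈ Set.Icc a b, (a : ℝ) ≤ x ∧ (x : ℝ) ≤ b := fun x hx => ⟨hx.1, hx.2⟩
    simp only [coe_shrink, ← hcdef]
    rcases lt_or_ge (a : ℝ) (c / 2) with h | h
    · refine ⟨-1, fun x hx => ?_⟩
      obtain ⟨hx1, hx2⟩ := cases3 x hx
      have := h1 h
      rw [shrinkFun_of_le_half x.2.1 (by linarith), shrinkFun_of_le_half ha (by linarith)]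
      norm_num
      ring
    rcases lt_or_ge (a : ℝ) (3 * c / 4) with h' | h'
    · refine ⟨0, fun x hx => ?_⟩
      obtain ⟨hx1, hx2⟩ := cases3 x hx
      have := h2 h'
      rw [shrinkFun_of_mid (by linarith) (by linarith),
        shrinkFun_of_mid (by linarith) (by linarith)]
      norm_num
    rcases lt_or_ge (a : ℝ) c with h'' | h''
    · refine ⟨1, fun x hx => ?_⟩
      obtain ⟨hx1, hx2⟩ := cases3 x hx
      have := h3 h''
      rw [shrinkFun_of_upper hc.le (by linarith) (by linarith),
        shrinkFun_of_upper hc.le (by linarith) (by linarith)]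
      norm_num
      ring
    · refine ⟨0, fun x hx => ?_⟩
      obtain ⟨hx1, hx2⟩ := cases3 x hx
      rw [shrinkFun_of_ge (by linarith), shrinkFun_of_ge (by linarith)]
      norm_num

/-- The subgroup generated by `shrink 0` and `shrink 1`. -/
noncomputable def generated : Subgroup (unitInterval ≃o unitInterval) :=
  Subgroup.closure {shrink 0, shrink 1}

theorem generated_le : generated ≤ ThompsonF := by
  rw [generated, Subgroup.closure_le]
  rintro _ (rfl | rfl)
  · exact isDyadicPL_shrink 0
  · exact isDyadicPL_shrink 1

/-- For `m ≥ 1` the support of `shrink m` lies in `[0, 1 / 2]`, where `shrink 0` is halving. -/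
theorem shrink_succ {m : ℕ} (hm : 1 ≤ m) :
    shrink (m + 1) = shrink 0 * shrink m * (shrink 0)⁻¹ := by
  rw [eq_mul_inv_iff_mul_eq]
  ext s
  rw [RelIso.mul_apply, RelIso.mul_apply]
  simp only [coe_shrink]
  have hc := pow_inv_pos m
  have hc1 : (2⁻¹ : ℝ) ^ m ≤ 1 / 2 := by
    obtain ⟨l, rfl⟩ := Nat.exists_eq_add_of_le' hm
    have := pow_inv_le_one l
    rw [pow_succ]
    linarith
  rw [pow_zero, pow_succ]
  set c : ℝ := 2⁻¹ ^ m
  have hs := s.2.1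
  rcases le_total (s : ℝ) c with h | h
  · rw [shrinkFun_of_le_half hs (by linarith)]
    have hle : shrinkFun c s ≤ s := min_le_left _ _
    have h0 : 0 ≤ shrinkFun c s := le_min hs (le_max_of_le_right (by linarith))
    rw [shrinkFun_of_le_half h0 (by linarith)]
    rcases le_total (s : ℝ) (c / 2) with h1 | h1
    · rw [shrinkFun_of_le_half hs h1, shrinkFun_of_le_half (by linarith) (by linarith)]
    rcases le_total (s : ℝ) (3 * c / 4) with h2 | h2
    · rw [shrinkFun_of_mid h1 h2, shrinkFun_of_mid (by linarith) (by linarith)]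
      ring
    · rw [shrinkFun_of_upper hc.le h2 h,
        shrinkFun_of_upper (by linarith) (by linarith) (by linarith)]
      ring
  · rw [shrinkFun_of_ge h, shrinkFun_of_ge]
    calc c * 2⁻¹ = shrinkFun 1 c := by
          rw [shrinkFun_of_le_half hc.le (by linarith)]; ring
      _ ≤ _ := shrinkFun_mono 1 h

theorem shrink_mem (m : ℕ) : shrink m ∈ generated := by
  have h0 : shrink 0 ∈ generated := Subgroup.subset_closure (Or.inl rfl)
  have h1 : ∀ l, shrink (l + 1) ∈ generated := by
    intro l
    induction l with
    | zero => exact Subgroup.subset_closure (Or.inr rfl)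
    | succ l ih =>
      rw [shrink_succ (by omega)]
      exact mul_mem (mul_mem h0 ih) (inv_mem h0)
  cases m with
  | zero => exact h0
  | succ l => exact h1 l


/-! ### Maps that are standard on the intervals between powers of 1/2 -/

/-- The map `h` sends each interval `[2⁻¹ ^ (m + 1), 2⁻¹ ^ m]` affinely onto the standard dyadic
interval `[j m / 2 ^ k m, (j m + 1) / 2 ^ k m]`, where `j m = 1` for `m ≥ N`. -/
structure IsStandard (h : unitInterval ≃o unitInterval) (N : ℕ) (k j : ℕ → ℕ) : Prop where
  eq : ∀ (m : ℕ) (t : unitInterval), (2⁻¹ : ℝ) ^ (m + 1) ≤ t → (t : ℝ) ≤ 2⁻¹ ^ m →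
    (h t : ℝ) * 2 ^ k m = j m + (2 ^ (m + 1) * t - 1)
  tail : ∀ m, N ≤ m → j m = 1

theorem two_pow_mul_inv_pow (m : ℕ) : (2 : ℝ) ^ m * 2⁻¹ ^ m = 1 := by
  rw [← mul_pow]; norm_num

namespace IsStandard

variable {h : unitInterval ≃o unitInterval} {N : ℕ} {k j : ℕ → ℕ}

/-- The point `2⁻¹ ^ m` of the unit interval. -/
noncomputable def pt (m : ℕ) : unitInterval := ⟨2⁻¹ ^ m, (pow_inv_pos m).le, pow_inv_le_one m⟩

theorem top (H : IsStandard h N k j) (m : ℕ) : (h (pt m) : ℝ) * 2 ^ k m = j m + 1 := by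
  have := H.eq m (pt m) (pow_le_pow_of_le_one (by norm_num) (by norm_num) (Nat.le_succ m)) le_rfl
  rw [this, pt, pow_succ, mul_right_comm, two_pow_mul_inv_pow]
  ring

theorem bot (H : IsStandard h N k j) (m : ℕ) : (h (pt (m + 1)) : ℝ) * 2 ^ k m = j m := by
  have := H.eq m (pt (m + 1)) le_rfl
    (pow_le_pow_of_le_one (by norm_num) (by norm_num) (Nat.le_succ m))
  rw [this, pt, two_pow_mul_inv_pow]
  ring

/-- The bottom of image `m` is the top of image `m + 1`. -/
theorem rel (H : IsStandard h N k j) (m : ℕ) :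
    (j (m + 1) + 1) * 2 ^ k m = j m * 2 ^ k (m + 1) := by
  have h1 := H.top (m + 1)
  have h2 := H.bot m
  have : ((j (m + 1) : ℝ) + 1) * 2 ^ k m = j m * 2 ^ k (m + 1) := by
    rw [← h1, ← h2]; ring
  exact_mod_cast this

theorem rel_zero (H : IsStandard h N k j) : j 0 + 1 = 2 ^ k 0 := by
  have h1 := H.top 0
  have e : pt 0 = ⊤ := Subtype.ext (by simp [pt])
  rw [e, map_top] at h1
  have : ((j 0 : ℝ) + 1) = 2 ^ k 0 := by rw [← h1]; simp
  exact_mod_cast this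

theorem lt_two_pow (H : IsStandard h N k j) (m : ℕ) : j m < 2 ^ k m := by
  have h1 := H.top m
  have h2 := (h (pt m)).2.2
  have h3 : (j m : ℝ) + 1 ≤ 2 ^ k m := by
    rw [← h1]
    exact mul_le_of_le_one_left (by positivity) h2
  have : j m + 1 ≤ 2 ^ k m := by exact_mod_cast h3
  omega

theorem pos (H : IsStandard h N k j) (m : ℕ) : 0 < j m := by
  have := H.rel m
  rcases Nat.eq_zero_or_pos (j m) with h0 | h0
  · rw [h0, zero_mul] at this
    exact absurd this (by positivity)
  · exact h0

theorem exists_mem_interval {t : unitInterval} (ht : 0 < (t : ℝ)) :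
    ∃ m : ℕ, (2⁻¹ : ℝ) ^ (m + 1) ≤ t ∧ (t : ℝ) ≤ 2⁻¹ ^ m := by
  obtain ⟨n, h1, h2⟩ := exists_nat_pow_near_of_lt_one ht t.2.2 (by norm_num : (0 : ℝ) < 2⁻¹)
    (by norm_num)
  exact ⟨n, h1.le, h2⟩

theorem eq_one (H : IsStandard h N k j) (hj : ∀ m, j m = 1) : h = 1 := by
  have hk : ∀ m, k m = m + 1 := by
    intro m
    induction m with
    | zero =>
      have := H.rel_zero
      rw [hj] at this
      exact (Nat.pow_right_injective le_rfl (by simpa using this)).symm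
    | succ m ih =>
      have := H.rel m
      rw [hj, hj, ih, one_mul, ← pow_succ'] at this
      exact (Nat.pow_right_injective le_rfl this).symm
  ext t
  rcases eq_or_lt_of_le t.2.1 with h0 | h0
  · have : t = ⊥ := Subtype.ext h0.symm
    rw [this, map_bot]
    simp
  · obtain ⟨m, h1, h2⟩ := exists_mem_interval h0
    have := H.eq m t h1 h2
    rw [hj, hk] at this
    have h3 : (h t : ℝ) * 2 ^ (m + 1) = t * 2 ^ (m + 1) := by rw [this]; push_cast; ring
    exact mul_right_cancel₀ (by positivity) h3

/-- Two adjacent intervals are mapped to the two halves of a standard dyadic interval. -/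
theorem exists_siblings (H : IsStandard h N k j) (hj : ∃ m, j m ≠ 1) :
    ∃ m J, m + 1 < N ∧ k (m + 1) = k m ∧ j (m + 1) = 2 * J ∧ j m = 2 * J + 1 := by
  have hN : ∀ m, j m ≠ 1 → m < N := fun m hm => by
    by_contra hlt
    exact hm (H.tail m (not_lt.1 hlt))
  -- Take a smallest image among those with `j m ≠ 1`. Its neighbour on the side of its sibling is
  -- not larger, by parity, and not smaller, by minimality.
  obtain ⟨m, hm, hmax⟩ : ∃ m, j m ≠ 1 ∧ ∀ m', j m' ≠ 1 → k m' ≤ k m := by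
    obtain ⟨m₀, hm₀⟩ := hj
    obtain ⟨m, hm, hmax⟩ := Finset.exists_max_image ((Finset.range N).filter fun m => j m ≠ 1) k
      ⟨m₀, by simp [hm₀, hN m₀ hm₀]⟩
    refine ⟨m, (Finset.mem_filter.1 hm).2, fun m' hm' => hmax m' ?_⟩
    simp [hm', hN m' hm']
  have hpos := H.pos m
  rcases Nat.even_or_odd' (j m) with ⟨J, hJ | hJ⟩
  -- An even `j m` marks a left half, so the sibling is image `m - 1`. It exists because image 0
  -- ends at 1 and is therefore a right half.
  · have hm0 : m ≠ 0 := by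
      rintro rfl
      have h0 := H.rel_zero
      have hk : k 0 ≠ 0 := fun hk => by rw [hk] at h0; omega
      obtain ⟨l, hl⟩ := Nat.exists_eq_succ_of_ne_zero hk
      rw [hl, Nat.succ_eq_add_one, pow_succ] at h0
      omega
    obtain ⟨l, rfl⟩ := Nat.exists_eq_succ_of_ne_zero hm0
    rw [Nat.succ_eq_add_one] at *
    have hrel := H.rel l
    rcases le_or_gt (k l) (k (l + 1)) with hk | hk
    · obtain ⟨e, he⟩ := Nat.exists_eq_add_of_le hk
      have h1 : j (l + 1) + 1 = j l * 2 ^ e := by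
        refine Nat.eq_of_mul_eq_mul_right (show 0 < 2 ^ k l by positivity) ?_
        rw [hrel, he, pow_add]; ring
      cases e with
      | zero => exact ⟨l, J, hN _ hm, by omega, hJ, by rw [pow_zero] at h1; omega⟩
      | succ e =>
        rw [pow_succ, ← mul_assoc] at h1
        omega
    · obtain ⟨e, he⟩ := Nat.exists_eq_add_of_lt hk
      have h1 : (j (l + 1) + 1) * 2 ^ e * 2 = j l := by
        refine Nat.eq_of_mul_eq_mul_right (show 0 < 2 ^ k (l + 1) by positivity) ?_
        rw [← hrel, he, pow_add, pow_add]; ring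
      have := hmax l (by omega)
      omega
  · have hrel := H.rel m
    rcases le_or_gt (k (m + 1)) (k m) with hk | hk
    · obtain ⟨e, he⟩ := Nat.exists_eq_add_of_le hk
      have h1 : (j (m + 1) + 1) * 2 ^ e = j m := by
        refine Nat.eq_of_mul_eq_mul_right (show 0 < 2 ^ k (m + 1) by positivity) ?_
        rw [← hrel, he, pow_add]; ring
      cases e with
      | zero =>
        rw [pow_zero] at h1
        exact ⟨m, J, hN _ (by omega), by omega, by omega, hJ⟩
      | succ e =>
        rw [pow_succ, ← mul_assoc] at h1
        omega
    · obtain ⟨e, he⟩ := Nat.exists_eq_add_of_lt hk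
      have h1 : j (m + 1) + 1 = j m * (2 ^ e * 2) := by
        refine Nat.eq_of_mul_eq_mul_right (show 0 < 2 ^ k m by positivity) ?_
        rw [hrel, he, pow_add, pow_add]; ring
      have h2 : j m * 2 ≤ j m * (2 ^ e * 2) := by
        gcongr
        exact Nat.le_mul_of_pos_left _ (by positivity)
      have := hmax (m + 1) (by omega)
      omega

/-- `shrink m` carries interval `m` onto the union of intervals `m` and `m + 1`, and each later
interval onto the next one. Siblings have equal slopes under `h` up to the factor 2 that `shrink m`
compensates. -/
theorem merge (H : IsStandard h N k j) {m J : ℕ} (hmN : m + 1 < N) (hk : k (m + 1) = k m)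
    (hj1 : j (m + 1) = 2 * J) (hj0 : j m = 2 * J + 1) :
    ∃ k' j', IsStandard (h * shrink m) (N - 1) k' j' := by
  have hkm : k m ≠ 0 := fun h0 => by
    have h1 := H.lt_two_pow m
    have h2 := H.pos (m + 1)
    rw [h0] at h1
    omega
  obtain ⟨K, hK⟩ := Nat.exists_eq_succ_of_ne_zero hkm
  refine ⟨fun i => if i < m then k i else if i = m then K else k (i + 1),
    fun i => if i < m then j i else if i = m then J else j (i + 1), ⟨fun i t h1 h2 => ?_,
      fun i hi => ?_⟩⟩
  · have hc := pow_inv_pos m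
    have e := two_pow_mul_inv_pow m
    have ht := coe_shrink m t
    rw [RelIso.mul_apply]
    rcases lt_trichotomy i m with hi | rfl | hi
    · simp only [hi, if_true]
      have hle : (2⁻¹ : ℝ) ^ m ≤ 2⁻¹ ^ (i + 1) :=
        pow_le_pow_of_le_one (by norm_num) (by norm_num) hi
      rw [shrinkFun_of_ge (hle.trans h1)] at ht
      have ht : shrink m t = t := Subtype.ext ht
      rw [ht]
      exact H.eq i t h1 h2
    · simp only [lt_irrefl, if_false, if_true]
      rw [pow_succ] at h1
      rcases le_total (t : ℝ) (3 * 2⁻¹ ^ i / 4) with h3 | h3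
      · rw [shrinkFun_of_mid (by linarith) h3] at ht
        have := H.eq (i + 1) (shrink i t) (by rw [ht, pow_succ, pow_succ]; linarith)
          (by rw [ht, pow_succ]; linarith)
        rw [hk, hK, hj1, ht, Nat.succ_eq_add_one, pow_succ] at this
        push_cast at this
        have e' : (2 : ℝ) ^ (i + 1 + 1) * (t - 2⁻¹ ^ i / 4) = 2 * (2 ^ (i + 1) * t) - 1 := by
          rw [pow_succ, pow_succ]; linear_combination -e
        linarith
      · rw [shrinkFun_of_upper hc.le h3 h2] at ht
        have := H.eq i (shrink i t) (by rw [ht, pow_succ]; linarith) (by rw [ht]; linarith)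
        rw [hK, hj0, ht, Nat.succ_eq_add_one, pow_succ] at this
        push_cast at this
        have e' : (2 : ℝ) ^ (i + 1) * (2 * t - 2⁻¹ ^ i) = 2 * (2 ^ (i + 1) * t) - 2 := by
          rw [pow_succ]; linear_combination -2 * e
        linarith
    · simp only [hi.not_gt, hi.ne', if_false]
      have hle : (2⁻¹ : ℝ) ^ i ≤ 2⁻¹ ^ (m + 1) :=
        pow_le_pow_of_le_one (by norm_num) (by norm_num) hi
      have hle2 : (2⁻¹ : ℝ) ^ (m + 1) = 2⁻¹ ^ m / 2 := by rw [pow_succ]; ring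
      rw [shrinkFun_of_le_half t.2.1 (by linarith)] at ht
      have := H.eq (i + 1) (shrink m t) (by rw [ht, pow_succ]; linarith)
        (by rw [ht, pow_succ]; linarith)
      rw [this, ht, pow_succ]
      ring
  · have h1 : ¬ i < m := by omega
    have h2 : i ≠ m := by omega
    simp only [h1, h2, if_false]
    exact H.tail _ (by omega)

/-- The inverse of merging: image `m` is halved and the later ones move up one index. -/
theorem split (H : IsStandard h N k j) (m : ℕ) :
    IsStandard (h * (shrink m)⁻¹) (max N (m + 1) + 1)
      (fun i => if i < m then k i else if i ≤ m + 1 then k m + 1 else k (i - 1))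
      (fun i => if i < m then j i else if i = m then 2 * j m + 1 else
        if i = m + 1 then 2 * j m else j (i - 1)) := by
  refine ⟨fun i t h1 h2 => ?_, fun i hi => ?_⟩
  · have hc := pow_inv_pos m
    have e := two_pow_mul_inv_pow m
    have ht := coe_shrink_inv m t
    rw [RelIso.mul_apply]
    rcases lt_or_ge i m with hi | hi
    · simp only [hi, if_true]
      have hle : (2⁻¹ : ℝ) ^ m ≤ 2⁻¹ ^ (i + 1) :=
        pow_le_pow_of_le_one (by norm_num) (by norm_num) hi
      rw [stretchFun_of_ge (hle.trans h1)] at ht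
      have ht : (shrink m)⁻¹ t = t := Subtype.ext ht
      rw [ht]
      exact H.eq i t h1 h2
    rcases (show i = m ∨ i = m + 1 ∨ m + 2 ≤ i by omega) with rfl | rfl | hi2
    · simp only [lt_irrefl, if_false, if_true, Nat.le_succ]
      rw [pow_succ] at h1
      rw [stretchFun_of_upper hc.le (by linarith) h2] at ht
      have := H.eq i ((shrink i)⁻¹ t) (by rw [ht, pow_succ]; linarith) (by rw [ht]; linarith)
      rw [pow_succ, ← mul_assoc, this, ht, pow_succ]
      push_cast
      linear_combination 2 * e
    · have hn : ¬ m + 1 < m := by omega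
      simp only [hn, if_false, if_true, le_refl, Nat.succ_ne_self]
      rw [pow_succ, pow_succ] at h1
      rw [pow_succ] at h2
      rw [stretchFun_of_mid (by linarith) (by linarith)] at ht
      have := H.eq m ((shrink m)⁻¹ t) (by rw [ht, pow_succ]; linarith) (by rw [ht]; linarith)
      rw [pow_succ, ← mul_assoc, this, ht, pow_succ, pow_succ]
      push_cast
      linear_combination e
    · obtain ⟨l, rfl⟩ := Nat.exists_eq_add_of_le' (show 1 ≤ i by omega)
      have hn1 : ¬ l + 1 < m := by omega
      have hn2 : ¬ l + 1 ≤ m + 1 := by omega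
      have hn3 : ¬ l + 1 = m := by omega
      have hn4 : ¬ l + 1 = m + 1 := by omega
      simp only [hn1, hn2, hn3, hn4, if_false, Nat.add_sub_cancel]
      have hle : (2⁻¹ : ℝ) ^ (l + 1) ≤ 2⁻¹ ^ (m + 2) :=
        pow_le_pow_of_le_one (by norm_num) (by norm_num) hi2
      have hle2 : (2⁻¹ : ℝ) ^ (m + 2) = 2⁻¹ ^ m / 4 := by rw [pow_add]; ring
      rw [stretchFun_of_le_quarter t.2.1 (by linarith)] at ht
      rw [pow_succ] at h1 h2
      have := H.eq l ((shrink m)⁻¹ t) (by rw [ht]; linarith)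
        (by rw [ht]; linarith)
      rw [this, ht, pow_succ]
      ring
  · have hn1 : ¬ i < m := by omega
    have hn3 : ¬ i = m := by omega
    have hn4 : ¬ i = m + 1 := by omega
    simp only [hn1, hn3, hn4, if_false]
    exact H.tail _ (by omega)

theorem mem_generated (H : IsStandard h N k j) : h ∈ generated := by
  induction N generalizing h k j with
  | zero =>
    rw [H.eq_one fun m => H.tail m (Nat.zero_le m)]
    exact one_mem _
  | succ N ih =>
    by_cases hj : ∃ m, j m ≠ 1
    · obtain ⟨m, J, h1, h2, h3, h4⟩ := H.exists_siblings hj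
      obtain ⟨k', j', H'⟩ := H.merge h1 h2 h3 h4
      exact (mul_mem_cancel_right (shrink_mem m)).1 (ih H')
    · push Not at hj
      rw [H.eq_one hj]
      exact one_mem _

/-- From index `N` on, each image is half the size of the previous one. -/
theorem le_add (H : IsStandard h N k j) (m : ℕ) : m ≤ k m + N := by
  have hrec : ∀ i, i ≤ k (N + i) := by
    intro i
    induction i with
    | zero => exact Nat.zero_le _
    | succ i ih =>
      have := H.rel (N + i)
      rw [H.tail _ (by omega), H.tail _ (by omega), one_mul, show 1 + 1 = 2 from rfl,
        ← pow_succ'] at this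
      have := Nat.pow_right_injective le_rfl this
      simp only [← add_assoc]
      omega
  rcases le_total N m with hm | hm
  · have := hrec (m - N)
    rw [Nat.add_sub_cancel' hm] at this
    omega
  · omega

theorem one : IsStandard 1 0 (fun m => m + 1) (fun _ => 1) :=
  ⟨fun m t _ _ => by simp [mul_comm], fun _ _ => rfl⟩

/-- There are standard maps with arbitrarily small image intervals. -/
theorem exists_fine (n : ℕ) :
    ∃ h ∈ generated, ∃ N k j, IsStandard h N k j ∧ ∀ m, n ≤ k m := by
  induction n with
  | zero => exact ⟨1, one_mem _, 0, _, _, one, fun m => Nat.zero_le _⟩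
  | succ n ih =>
    -- Only indices below `M` may still be too coarse. Splitting the last of them repairs it and
    -- leaves the smaller indices untouched.
    have key : ∀ M h N k j, h ∈ generated → IsStandard h N k j → (∀ m, n ≤ k m) →
        (∀ m, M ≤ m → n + 1 ≤ k m) →
        ∃ h ∈ generated, ∃ N k j, IsStandard h N k j ∧ ∀ m, n + 1 ≤ k m := by
      intro M
      induction M with
      | zero => exact fun h N k j hg H _ hk => ⟨h, hg, N, k, j, H, fun m => hk m (Nat.zero_le m)⟩
      | succ M ihM =>
        intro h N k j hg H hk hk'
        refine ihM _ _ _ _ (mul_mem hg (inv_mem (shrink_mem M))) (H.split M) (fun m => ?_)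
          fun m hm => ?_
        · have := hk m
          have := hk M
          have := hk (m - 1)
          split_ifs <;> omega
        · have h1 : ¬ m < M := by omega
          simp only [h1, if_false]
          split_ifs with h2
          · have := hk M
            omega
          · exact hk' _ (by omega)
    obtain ⟨h, hg, N, k, j, H, hk⟩ := ih
    refine key (n + 1 + N) h N k j hg H hk fun m hm => ?_
    have := H.le_add m
    omega

end IsStandard

/-! ### Elements of F on small dyadic intervals -/

theorem exists_two_pow_mul_eq (D : Finset unitInterval) (hD : ∀ d ∈ D, IsDyadic (d : ℝ)) :
    ∃ n : ℕ, ∀ d ∈ D, ∃ p : ℤ, (d : ℝ) * 2 ^ n = p := by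
  classical
  induction D using Finset.induction_on with
  | empty => exact ⟨0, by simp⟩
  | insert d D _ ih =>
    obtain ⟨n, hn⟩ := ih fun e he => hD e (Finset.mem_insert_of_mem he)
    obtain ⟨p, m, hp⟩ := hD d (Finset.mem_insert_self _ _)
    refine ⟨m + n, fun e he => ?_⟩
    rcases Finset.mem_insert.1 he with rfl | he
    · refine ⟨p * 2 ^ n, ?_⟩
      rw [hp, pow_add]
      push_cast
      field_simp
    · obtain ⟨p', hp'⟩ := hn e he
      refine ⟨p' * 2 ^ m, ?_⟩
      rw [pow_add]
      push_cast
      rw [← hp']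
      ring

/-- An element of Thompson's group is affine on all dyadic intervals of a certain level. -/
theorem exists_affine {f : unitInterval ≃o unitInterval} (hf : IsDyadicPL f) :
    ∃ n : ℕ, ∀ i : ℕ, i < 2 ^ n → ∃ (e p : ℤ) (q : ℕ), ∀ x : unitInterval,
      (i : ℝ) ≤ x * 2 ^ n → (x : ℝ) * 2 ^ n ≤ i + 1 →
        (f x : ℝ) = p / 2 ^ q + 2 ^ e * (x - i / 2 ^ n) := by
  obtain ⟨D, hD, h⟩ := id hf
  obtain ⟨n, hn⟩ := exists_two_pow_mul_eq D hD
  refine ⟨n, fun i hi => ?_⟩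
  have hpow : (0 : ℝ) < 2 ^ n := by positivity
  have hi' : (i : ℝ) + 1 ≤ 2 ^ n := by exact_mod_cast hi
  let a : unitInterval := ⟨i / 2 ^ n, by positivity, by rw [div_le_one hpow]; linarith⟩
  let b : unitInterval := ⟨(i + 1) / 2 ^ n, by positivity, by rw [div_le_one hpow]; linarith⟩
  have hab : a ≤ b := by
    change (i : ℝ) / 2 ^ n ≤ (i + 1) / 2 ^ n
    gcongr
    linarith
  obtain ⟨e, he⟩ := h a b hab (by
    rintro d hd ⟨h1, h2⟩
    obtain ⟨p, hp⟩ := hn d hd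
    have h1 : (i : ℝ) / 2 ^ n < d := h1
    have h2 : (d : ℝ) < (i + 1) / 2 ^ n := h2
    rw [div_lt_iff₀ hpow, hp] at h1
    rw [lt_div_iff₀ hpow, hp] at h2
    have h1 : (i : ℤ) < p := by exact_mod_cast h1
    have h2 : p < (i : ℤ) + 1 := by exact_mod_cast h2
    omega)
  obtain ⟨p, q, hpq⟩ := hf.map_dyadic a ⟨i, n, by simp [a]⟩
  refine ⟨e, p, q, fun x h1 h2 => ?_⟩
  rw [he x ⟨?_, ?_⟩, hpq]
  · change (i : ℝ) / 2 ^ n ≤ x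
    rwa [div_le_iff₀ hpow]
  · change (x : ℝ) ≤ (i + 1) / 2 ^ n
    rwa [le_div_iff₀ hpow]

/-- An element of Thompson's group maps all sufficiently small standard dyadic intervals affinely
onto standard dyadic intervals. -/
theorem exists_map_standard {f : unitInterval ≃o unitInterval} (hf : IsDyadicPL f) :
    ∃ n : ℕ, ∀ k j : ℕ, n ≤ k → j < 2 ^ k → ∃ k' j' : ℕ, (∀ x : unitInterval,
      (j : ℝ) ≤ x * 2 ^ k → (x : ℝ) * 2 ^ k ≤ j + 1 →
        (f x : ℝ) * 2 ^ k' = j' + (x * 2 ^ k - j)) ∧ (j = 1 → j' = 1) := by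
  obtain ⟨n, hn⟩ := exists_affine hf
  choose! e p q h using hn
  -- The supremum makes the left endpoint values `p / 2 ^ q` integral at the image level `k - e`.
  -- The extra 1 puts interval `j = 1` in the same affine piece as 0, which forces `j' = 1`.
  refine ⟨n + 1 + (Finset.range (2 ^ n)).sup fun i => (e i).toNat + q i, fun k j hk hj => ?_⟩
  obtain ⟨l, rfl⟩ := Nat.exists_eq_add_of_le (show n + 1 ≤ k by omega)
  set i := j / 2 ^ (l + 1) with hi
  have hi1 : i < 2 ^ n := by
    rw [hi, Nat.div_lt_iff_lt_mul (by positivity), ← pow_add]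
    rwa [show n + (l + 1) = n + 1 + l by ring]
  have hi2 : i * 2 ^ (l + 1) ≤ j := Nat.div_mul_le_self _ _
  have hi3 : j + 1 ≤ (i + 1) * 2 ^ (l + 1) := by
    rw [mul_comm]
    exact Nat.lt_mul_div_succ j (by positivity)
  have hsup : (e i).toNat + q i ≤ l := by
    have := Finset.le_sup (f := fun i => (e i).toNat + q i) (Finset.mem_range.2 hi1)
    omega
  obtain ⟨r, hr⟩ : ∃ r : ℕ, (r : ℤ) = (n + 1 + l : ℕ) - e i - q i :=
    ⟨((n + 1 + l : ℕ) - e i - q i).toNat, by omega⟩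
  have hE : (2 : ℝ) ^ e i * 2 ^ (r + q i) = 2 ^ (n + 1 + l) := by
    rw [← zpow_natCast, ← zpow_natCast, ← zpow_add₀ (by norm_num)]
    congr 1
    push_cast at *
    omega
  have hw : (2 : ℝ) ^ (n + 1 + l) = 2 ^ n * 2 ^ (l + 1) := by rw [← pow_add]; congr 1; ring
  have hw0 : (0 : ℝ) < 2 ^ (l + 1) := by positivity
  have hn0 : (0 : ℝ) < 2 ^ n := by positivity
  have key : ∀ x : unitInterval, (i : ℝ) ≤ x * 2 ^ n → (x : ℝ) * 2 ^ n ≤ i + 1 →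
      (f x : ℝ) * 2 ^ (r + q i) =
        ((p i * 2 ^ r + j - i * 2 ^ (l + 1) : ℤ) : ℝ) + (x * 2 ^ (n + 1 + l) - j) := by
    intro x h1 h2
    rw [h i hi1 x h1 h2, add_mul, mul_right_comm, hE, pow_add, hw]
    push_cast
    field_simp
    ring
  have hpiece : ∀ x : unitInterval, (j : ℝ) ≤ x * 2 ^ (n + 1 + l) →
      (x : ℝ) * 2 ^ (n + 1 + l) ≤ j + 1 → (i : ℝ) ≤ x * 2 ^ n ∧ (x : ℝ) * 2 ^ n ≤ i + 1 := by
    intro x h1 h2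
    have hi2' : (i : ℝ) * 2 ^ (l + 1) ≤ j := by exact_mod_cast hi2
    have hi3' : (j : ℝ) + 1 ≤ (i + 1) * 2 ^ (l + 1) := by exact_mod_cast hi3
    rw [hw, ← mul_assoc] at h1 h2
    exact ⟨le_of_mul_le_mul_right (hi2'.trans h1) hw0, le_of_mul_le_mul_right (h2.trans hi3') hw0⟩
  have hz : 0 ≤ p i * 2 ^ r + j - i * 2 ^ (l + 1) := by
    have hj' : (j : ℝ) ≤ 2 ^ (n + 1 + l) := by exact_mod_cast hj.le
    let x : unitInterval := ⟨j / 2 ^ (n + 1 + l), by positivity,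
      by rw [div_le_one (by positivity)]; exact hj'⟩
    have hx : (x : ℝ) * 2 ^ (n + 1 + l) = j := div_mul_cancel₀ _ (by positivity)
    obtain ⟨h1, h2⟩ := hpiece x hx.ge (by rw [hx]; linarith)
    have := key x h1 h2
    rw [hx, sub_self, add_zero] at this
    have h0 : (0 : ℝ) ≤ (f x : ℝ) * 2 ^ (r + q i) := mul_nonneg (f x).2.1 (by positivity)
    rw [this] at h0
    exact_mod_cast h0
  obtain ⟨z, hz'⟩ := Int.eq_ofNat_of_zero_le hz
  refine ⟨r + q i, z, fun x h1 h2 => ?_, fun hj1 => ?_⟩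
  · obtain ⟨h3, h4⟩ := hpiece x h1 h2
    rw [key x h3 h4, hz']
    rfl
  · have hi0 : i = 0 := by
      rw [hi, hj1]
      exact Nat.div_eq_of_lt (Nat.one_lt_two_pow (by omega))
    have := key ⊥ (by rw [hi0]; simp) (by rw [hi0]; simp)
    rw [map_bot, hz', hj1] at this
    have h1 : ((z : ℤ) : ℝ) = 1 := by
      simp at this
      push_cast
      linarith
    exact_mod_cast h1

/-- If `h` is a generated standard map with images small enough for `f`, then `f * h` is standard,
so both `h` and `f * h` are generated. -/
theorem eq_generated : ThompsonF = generated := by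
  refine le_antisymm (fun f hf => ?_) generated_le
  have hf : IsDyadicPL f := hf
  obtain ⟨n, hn⟩ := exists_map_standard hf
  obtain ⟨h, hg, N, k, j, H, hk⟩ := IsStandard.exists_fine n
  choose! k' j' h1 h2 using hn
  have H' : IsStandard (f * h) N (fun m => k' (k m) (j m)) (fun m => j' (k m) (j m)) := by
    refine ⟨fun m t ht1 ht2 => ?_, fun m hm => h2 _ _ (hk m) (H.lt_two_pow m) (H.tail m hm)⟩
    have e := H.eq m t ht1 ht2
    have e1 := two_pow_mul_inv_pow (m + 1)
    have e2 := two_pow_mul_inv_pow m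
    have hp : (0 : ℝ) < 2 ^ (m + 1) := by positivity
    have b1 : 1 ≤ (2 : ℝ) ^ (m + 1) * t := by rw [← e1]; gcongr
    have b2 : (2 : ℝ) ^ (m + 1) * t ≤ 2 := by
      calc (2 : ℝ) ^ (m + 1) * t ≤ 2 ^ (m + 1) * 2⁻¹ ^ m := by gcongr
        _ = 2 := by rw [pow_succ, mul_right_comm, e2, one_mul]
    rw [RelIso.mul_apply, h1 _ _ (hk m) (H.lt_two_pow m) (h t) (by linarith) (by linarith), e]
    ring
  exact (mul_mem_cancel_right hg).1 H'.mem_generated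

theorem fg : Group.FG ThompsonF := by
  rw [Group.fg_iff_subgroup_fg, eq_generated]
  classical
  exact ⟨{shrink 0, shrink 1}, by simp [generated]⟩

/-! ### The homomorphisms given by the slopes at the endpoints -/

/-- The map `f` multiplies the coordinate `c` by `2 ^ k` where `c` is small. -/
def HasGerm (c : unitInterval → ℝ) (f : unitInterval ≃o unitInterval) (k : ℤ) : Prop :=
  ∃ ε > 0, ∀ x, c x ≤ ε → c (f x) = 2 ^ k * c x

section Germ

variable {c : unitInterval → ℝ} {f g : unitInterval ≃o unitInterval} {k l : ℤ}

theorem HasGerm.mul (hf : HasGerm c f k) (hg : HasGerm c g l) : HasGerm c (f * g) (k + l) := by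
  obtain ⟨ε, hε, hf⟩ := hf
  obtain ⟨δ, hδ, hg⟩ := hg
  have hl : (0 : ℝ) < 2 ^ l := by positivity
  refine ⟨min δ (ε / 2 ^ l), by positivity, fun x hx => ?_⟩
  have h1 := hg x (hx.trans (min_le_left _ _))
  have h2 : c (g x) ≤ ε := by
    rw [h1, ← le_div_iff₀' hl]
    exact hx.trans (min_le_right _ _)
  rw [RelIso.mul_apply, hf _ h2, h1, zpow_add₀ (by norm_num), mul_assoc]

theorem HasGerm.unique (hc : ∀ ε > 0, ∃ x, 0 < c x ∧ c x ≤ ε) (hk : HasGerm c f k)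
    (hl : HasGerm c f l) : k = l := by
  obtain ⟨ε, hε, hk⟩ := hk
  obtain ⟨δ, hδ, hl⟩ := hl
  obtain ⟨x, hx0, hx⟩ := hc (min ε δ) (lt_min hε hδ)
  have := (hk x (hx.trans (min_le_left _ _))).symm.trans (hl x (hx.trans (min_le_right _ _)))
  exact zpow_right_injective₀ (by norm_num : (0 : ℝ) < 2) (by norm_num)
    (mul_right_cancel₀ hx0.ne' this)

/-- The exponent is unique because `c` takes arbitrarily small positive values; additivity then
follows from `HasGerm.mul`. -/
theorem exists_germ_hom (hc : ∀ ε > 0, ∃ x, 0 < c x ∧ c x ≤ ε)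
    (h : ∀ f, IsDyadicPL f → ∃ k, HasGerm c f k) :
    ∃ a : ThompsonF → ℤ, (∀ f g, a (f * g) = a f + a g) ∧ ∀ f k, HasGerm c f.1 k → a f = k := by
  choose! a ha using h
  exact ⟨fun f => a f.1, fun f g => (ha _ (f * g).2).unique hc ((ha _ f.2).mul (ha _ g.2)),
    fun f k hk => (ha _ f.2).unique hc hk⟩

end Germ

theorem exists_hasGerm_zero {f : unitInterval ≃o unitInterval} (hf : IsDyadicPL f) :
    ∃ k, HasGerm (fun x => (x : ℝ)) f k := by
  obtain ⟨n, hn⟩ := exists_affine hf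
  obtain ⟨e, p, q, h⟩ := hn 0 (by positivity)
  have h0 := h ⊥ (by simp) (by simp)
  rw [map_bot] at h0
  simp only [Nat.cast_zero, zero_div, sub_zero, Set.Icc.coe_bot, mul_zero, add_zero] at h h0
  refine ⟨e, (2 ^ n)⁻¹, by positivity, fun x hx => ?_⟩
  dsimp only at hx ⊢
  rw [← h0] at h
  rw [h x (mul_nonneg x.2.1 (by positivity)), zero_add]
  rw [zero_add, ← le_div_iff₀ (by positivity), one_div]
  exact hx

theorem exists_hasGerm_one {f : unitInterval ≃o unitInterval} (hf : IsDyadicPL f) :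
    ∃ k, HasGerm (fun x => 1 - (x : ℝ)) f k := by
  obtain ⟨n, hn⟩ := exists_affine hf
  have hp : (0 : ℝ) < 2 ^ n := by positivity
  obtain ⟨i, hi⟩ := Nat.exists_eq_succ_of_ne_zero (show 2 ^ n ≠ 0 by positivity)
  obtain ⟨e, p, q, h⟩ := hn i (by omega)
  have hi' : (i : ℝ) + 1 = 2 ^ n := by exact_mod_cast hi.symm
  have h1 := h ⊤ (by simp; linarith) (by simp [hi'])
  rw [map_top] at h1
  refine ⟨e, (2 ^ n)⁻¹, by positivity, fun x hx => ?_⟩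
  dsimp only at hx ⊢
  have hx1 : (x : ℝ) * 2 ^ n ≤ 1 * 2 ^ n := mul_le_mul_of_nonneg_right x.2.2 hp.le
  have hx2 : (1 - (x : ℝ)) * 2 ^ n ≤ 1 := by
    rw [← le_div_iff₀ hp, one_div]
    exact hx
  rw [h x (by linarith) (by linarith)]
  simp only [Set.Icc.coe_top] at h1
  linear_combination h1

end ThompsonF

/-! ### The retraction of F onto the lattice -/

theorem mainTheorem11 :
    Group.FG ThompsonF ∧
      ∀ S : Set ThompsonF, S.Finite → Subgroup.closure S = ⊤ →
        CopGame.sCop (SimpleGraph.mulCayley S) = ⊤ := by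
  refine ⟨ThompsonF.fg, fun S hS hS' => ?_⟩
  obtain ⟨a, ha, ha'⟩ := ThompsonF.exists_germ_hom (c := fun x => (x : ℝ))
    (fun ε hε => ⟨⟨min ε 1, by positivity, min_le_right _ _⟩, by positivity, min_le_left _ _⟩)
    fun f hf => ThompsonF.exists_hasGerm_zero hf
  obtain ⟨b, hb, hb'⟩ := ThompsonF.exists_germ_hom (c := fun x => 1 - (x : ℝ))
    (fun ε hε => ⟨unitInterval.symm ⟨min ε 1, by positivity, min_le_right _ _⟩,
      by simp [hε], by simp⟩)
    fun f hf => ThompsonF.exists_hasGerm_one hf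
  have hmem : ∀ m, ThompsonF.shrink m ∈ ThompsonF := ThompsonF.isDyadicPL_shrink
  -- Near 0 the doubling by `(shrink 1)⁻¹` cancels the halving by `shrink 0`; near 1 only the slope
  -- 2 of `shrink 0` remains.
  have hv : ∀ s : unitInterval, (s : ℝ) ≤ 1 / 8 →
      (ThompsonF.shrink 0 * (ThompsonF.shrink 1)⁻¹) s = s := by
    intro s hs
    have h0 := s.2.1
    ext
    rw [RelIso.mul_apply, ThompsonF.coe_shrink, ThompsonF.coe_shrink_inv,
      ThompsonF.stretchFun_of_le_quarter h0 (by linarith),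
      ThompsonF.shrinkFun_of_le_half (by linarith) (by linarith)]
    ring
  refine CopGame.sCop_eq_top hS hS' a b ha hb ⟨(ThompsonF.shrink 3)⁻¹, inv_mem (hmem 3)⟩
    ⟨ThompsonF.shrink 0 * (ThompsonF.shrink 1)⁻¹, mul_mem (hmem 0) (inv_mem (hmem 1))⟩
    ?_ (ha' _ _ ⟨1 / 32, by norm_num, fun x hx => ?_⟩) (hb' _ _ ⟨7 / 8, by norm_num, fun x hx => ?_⟩)
    (ha' _ _ ⟨1 / 8, by norm_num, fun x hx => ?_⟩) (hb' _ _ ⟨1 / 4, by norm_num, fun x hx => ?_⟩)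
  -- `shrink 3` moves only points of `[0, 1 / 8]` and `v` only points of `[1 / 8, 1]`; each
  -- preserves both intervals.
  · have h : Commute (ThompsonF.shrink 3) (ThompsonF.shrink 0 * (ThompsonF.shrink 1)⁻¹) := by
      set v := ThompsonF.shrink 0 * (ThompsonF.shrink 1)⁻¹
      refine RelIso.ext fun s => ?_
      change ThompsonF.shrink 3 (v s) = v (ThompsonF.shrink 3 s)
      rcases le_total (s : ℝ) (1 / 8) with h | h
      · rw [hv s h, hv]
        rw [ThompsonF.coe_shrink]
        exact (min_le_left _ _).trans h
      · have h1 : ThompsonF.shrink 3 s = s :=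
          Subtype.ext (ThompsonF.shrinkFun_of_ge (by norm_num at h ⊢; exact h))
        have h2 : (1 / 8 : ℝ) ≤ v s := by
          let o : unitInterval := ⟨1 / 8, by norm_num, by norm_num⟩
          have h3 : v o ≤ v s := v.monotone h
          rw [hv o le_rfl] at h3
          exact h3
        rw [h1]
        exact Subtype.ext (ThompsonF.shrinkFun_of_ge (by norm_num at h2 ⊢; exact h2))
    exact Subtype.ext h.inv_left.eq
  · have h0 := x.2.1
    dsimp only at hx ⊢
    rw [ThompsonF.coe_shrink_inv, ThompsonF.stretchFun_of_le_quarter h0 (by norm_num; linarith)]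
    norm_num
  · dsimp only at hx ⊢
    rw [ThompsonF.coe_shrink_inv, ThompsonF.stretchFun_of_ge (by norm_num; linarith)]
    norm_num
  · dsimp only
    rw [hv x hx]
    norm_num
  · dsimp only at hx ⊢
    have h1 : ((ThompsonF.shrink 1)⁻¹ x : ℝ) = x := by
      rw [ThompsonF.coe_shrink_inv, ThompsonF.stretchFun_of_ge (by norm_num; linarith)]
    rw [RelIso.mul_apply, ThompsonF.coe_shrink, h1,
      ThompsonF.shrinkFun_of_upper (by norm_num) (by norm_num; linarith) (by norm_num; exact x.2.2)]
    norm_num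
    ring
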